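/- Let $G$ be a finite group, let $D$ be a set of nontrivial conjugacy classes of $G$ whose union generates $G$, let $\xi\colon D\to\mathbb{Z}_{\ge 1}$ be a map, put $|\xi|=\sum_{c\in D}\xi(c)$, and let $k$ be a field whose characteristic is $0$ or a prime not dividing $|G|$. The braid group $B_m$, with its Artin generators $\sigma_1,\dots,\sigma_{m-1}$, acts on $G^m$ by $$\sigma_i.(g_1,\dots,g_m)=(g_1,\dots,g_{i-1},\,g_ig_{i+1}g_i^{-1},\,g_i,\,g_{i+2},\dots,g_m).$$ Let $\mathrm{Comp}(G,\xi)$ be the graded monoid whose elements of degree $n\ge 0$ are the $B_{n|\xi|}$-orbits of tuples $(g_1,\dots,g_{n|\xi|})\in G^{n|\xi|}$ such that $g_1\cdots g_{n|\xi|}=1$ and, for every $c\in D$, exactly $n\,\xi(c)$ of the entries lie in $c$; the product is induced by concatenation of tuples. This monoid is commutative. Let $R(G,\xi)=k[\mathrm{Comp}(G,\xi)]$ be its monoid ring. A subgroup $H$ of $G$ is called $D$-generated if either $H=1$, or $H$ intersects every class in $D$ and $H$ is generated by $\bigsqcup_{c\in D}(c\cap H)$. If $H$ intersects every class in $D$,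 its splitting number is $\Omega_D(H)=|D_H|-|D|$, where $D_H$ is the set of conjugacy classes of $H$ which are contained in some class in $D$. Then the Krull dimension of $R(G,\xi)$ is $$\dim_{\mathrm{Krull}} R(G,\xi)=\Bigl(\max_{H}\,\Omega_D(H)\Bigr)+1,$$ where $H$ ranges over the $D$-generated subgroups of $G$ which intersect every class in $D$ (that is, those for which $\Omega_D(H)$ is defined). -/

import Mathlib

noncomputable section

namespace HurwitzComponents

/-! ### Braid groups and their action on tuples -/

/-- The defining relations of the Artin braid group on `n` strands. The generator with index
`i : Fin (n - 1)` is the elementary braid at the (zero-based) positions `i` and `i + 1`. -/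
def braidRels (n : ℕ) : Set (FreeGroup (Fin (n - 1))) :=
  {r | ∃ i j : Fin (n - 1), (i : ℕ) + 1 < j ∧
      r = (FreeGroup.of i * FreeGroup.of j) * (FreeGroup.of j * FreeGroup.of i)⁻¹} ∪
  {r | ∃ i j : Fin (n - 1), (i : ℕ) + 1 = j ∧
      r = (FreeGroup.of i * FreeGroup.of j * FreeGroup.of i) *
        (FreeGroup.of j * FreeGroup.of i * FreeGroup.of j)⁻¹}

/-- The Artin braid group on `n` strands. -/
abbrev BraidGroup (n : ℕ) : Type := PresentedGroup (braidRels n)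

section Action

variable {G : Type*} [Group G]

set_option linter.unusedSimpArgs false

/-- For positions `p ≠ q`, the permutation of `G ^ n` which replaces the entries
`(g p, g q)` by `(g p * g q * (g p)⁻¹, g p)` and leaves the others unchanged. -/
def hurwitzMove {n : ℕ} (p q : Fin n) (hpq : p ≠ q) : Equiv.Perm (Fin n → G) where
  toFun g := fun j => if j = p then g p * g q * (g p)⁻¹ else if j = q then g p else g j
  invFun g := fun j => if j = p then g q else if j = q then (g q)⁻¹ * g p * g q else g j
  left_inv g := by
    funext j
    by_cases h1 : j = p
    · subst h1; simp [hpq.symm]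
    · by_cases h2 : j = q
      · subst h2; simp [hpq.symm, mul_assoc]
      · simp [h1, h2]
  right_inv g := by
    funext j
    by_cases h1 : j = p
    · subst h1; simp [hpq.symm, mul_assoc]
    · by_cases h2 : j = q
      · subst h2; simp [hpq.symm]
      · simp [h1, h2]

/-- The action of the `i`-th elementary braid on `G ^ n`:
`(…, g_i, g_{i+1}, …) ↦ (…, g_i g_{i+1} g_i⁻¹, g_i, …)`. -/
def elementaryBraidPerm {n : ℕ} (i : Fin (n - 1)) : Equiv.Perm (Fin n → G) :=
  hurwitzMove ⟨i, by omega⟩ ⟨i + 1, by omega⟩ (by simp [Fin.ext_iff])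

theorem elementaryBraidPerm_apply {n : ℕ} (i : Fin (n - 1)) (g : Fin n → G) (j : Fin n) :
    elementaryBraidPerm i g j =
      if j = ⟨i, by omega⟩ then
        g ⟨i, by omega⟩ * g ⟨i + 1, by omega⟩ * (g ⟨i, by omega⟩)⁻¹
      else if j = ⟨i + 1, by omega⟩ then g ⟨i, by omega⟩ else g j :=
  rfl

theorem hurwitzMove_comm {n : ℕ} {p q r s : Fin n} (hpq : p ≠ q) (hrs : r ≠ s)
    (hpr : p ≠ r) (hps : p ≠ s) (hqr : q ≠ r) (hqs : q ≠ s) :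
    (hurwitzMove p q hpq : Equiv.Perm (Fin n → G)) * hurwitzMove r s hrs =
      hurwitzMove r s hrs * hurwitzMove p q hpq := by
  ext g j
  simp only [Equiv.Perm.mul_apply, hurwitzMove, Equiv.coe_fn_mk]
  by_cases h1 : j = p
  · subst h1; simp [hpr, hps, hqr, hqs, hpr.symm, hps.symm, hqr.symm, hqs.symm]
  · by_cases h2 : j = q
    · subst h2; simp [hpr, hps, hqr, hqs, hpr.symm, hps.symm, hqr.symm, hqs.symm, h1]
    · by_cases h3 : j = r
      · subst h3; simp [hpr, hps, hqr, hqs, hpr.symm, hps.symm, hqr.symm, hqs.symm]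
      · simp [h1, h2, h3, hpr, hps, hqr, hqs, hpr.symm, hps.symm, hqr.symm, hqs.symm]

theorem hurwitzMove_braid {n : ℕ} {p q r : Fin n} (hpq : p ≠ q) (hqr : q ≠ r) (hpr : p ≠ r) :
    (hurwitzMove p q hpq : Equiv.Perm (Fin n → G)) * hurwitzMove q r hqr * hurwitzMove p q hpq =
      hurwitzMove q r hqr * hurwitzMove p q hpq * hurwitzMove q r hqr := by
  ext g j
  simp only [Equiv.Perm.mul_apply, hurwitzMove, Equiv.coe_fn_mk]
  by_cases h1 : j = p
  · subst h1; simp [hpq, hqr, hpr, hpq.symm, hqr.symm, hpr.symm, mul_assoc]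
  · by_cases h2 : j = q
    · subst h2; simp [hpq, hqr, hpr, hpq.symm, hqr.symm, hpr.symm, mul_assoc]
    · by_cases h3 : j = r
      · subst h3; simp [hpq, hqr, hpr, hpq.symm, hqr.symm, hpr.symm]
      · simp [h1, h2, h3]

/-- The homomorphism from the braid group to the permutations of `G ^ n` which sends the
elementary braids to `elementaryBraidPerm`. -/
def braidHom (G : Type*) [Group G] (n : ℕ) : BraidGroup n →* Equiv.Perm (Fin n → G) :=
  PresentedGroup.toGroup (f := fun i => elementaryBraidPerm i) (by
    rintro _ (⟨i, j, hij, rfl⟩ | ⟨i, j, hij, rfl⟩)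
    · simp only [map_mul, map_inv, FreeGroup.lift_apply_of]
      rw [mul_inv_eq_one]
      apply hurwitzMove_comm <;> simp only [ne_eq, Fin.mk.injEq] <;> omega
    · simp only [map_mul, map_inv, FreeGroup.lift_apply_of]
      rw [mul_inv_eq_one]
      have hj : (⟨j, by omega⟩ : Fin n) = ⟨i + 1, by omega⟩ := Fin.ext hij.symm
      simp only [elementaryBraidPerm, hj]
      apply hurwitzMove_braid
      simp only [ne_eq, Fin.mk.injEq]; omega)

/-- The braid group action on tuples. -/
instance braidAction (n : ℕ) : MulAction (BraidGroup n) (Fin n → G) :=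
  MulAction.compHom _ (braidHom G n)

theorem of_smul {n : ℕ} (i : Fin (n - 1)) (g : Fin n → G) :
    ((PresentedGroup.of i : BraidGroup n) • g) = elementaryBraidPerm i g := by
  change braidHom G n (PresentedGroup.of i) g = _
  rw [braidHom, PresentedGroup.toGroup.of]

/-- Two tuples, written as lists, are braid equivalent if they have the same length `n` and lie
in the same orbit of the braid group on `n` strands. -/
def BraidEquiv (l l' : List G) : Prop :=
  ∃ (n : ℕ) (b : BraidGroup n) (g : Fin n → G), l = List.ofFn g ∧ l' = List.ofFn (b • g)

theorem BraidEquiv.refl (l : List G) : BraidEquiv l l :=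
  ⟨l.length, 1, l.get, by simp, by simp⟩

theorem BraidEquiv.symm {l l' : List G} (h : BraidEquiv l l') : BraidEquiv l' l := by
  obtain ⟨n, b, g, rfl, rfl⟩ := h
  exact ⟨n, b⁻¹, b • g, rfl, by simp⟩

theorem BraidEquiv.trans {l l' l'' : List G} (h : BraidEquiv l l') (h' : BraidEquiv l' l'') :
    BraidEquiv l l'' := by
  obtain ⟨n, b, g, rfl, rfl⟩ := h
  obtain ⟨m, c, g', h1, rfl⟩ := h'
  obtain rfl : n = m := by simpa using congrArg List.length h1
  obtain rfl := List.ofFn_injective h1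
  exact ⟨n, c * b, g, rfl, by rw [mul_smul]⟩

theorem ofFn_elementaryBraidPerm (l₁ l₂ : List G) (a b : G) (n : ℕ) (g : Fin n → G)
    (i : Fin (n - 1)) (hi : (i : ℕ) = l₁.length) (hg : List.ofFn g = l₁ ++ a :: b :: l₂) :
    List.ofFn (elementaryBraidPerm i g) = l₁ ++ (a * b * a⁻¹) :: a :: l₂ := by
  have hn : n = l₁.length + (l₂.length + 2) := by simpa using congrArg List.length hg
  have hget : ∀ (k : ℕ) (hk : k < n),
      g ⟨k, hk⟩ = (l₁ ++ a :: b :: l₂)[k]'(by simp; omega) := by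
    intro k hk
    simp [← hg]
  apply List.ext_getElem
  · simp; omega
  · intro k hk hk'
    have hkn : k < n := by simpa using hk
    simp only [List.getElem_ofFn, elementaryBraidPerm_apply, hi, Fin.mk.injEq, hget]
    rcases lt_trichotomy k l₁.length with h | h | h
    · simp [List.getElem_append_left, h, h.ne, (show k ≠ l₁.length + 1 by omega)]
    · subst h
      simp
    · obtain ⟨m, rfl⟩ : ∃ m, k = l₁.length + 1 + m := ⟨k - (l₁.length + 1), by omega⟩
      rcases m with _ | m
      · simp [List.getElem_append_right]
      · have e : l₁.length + 1 + (m + 1) - l₁.length = m + 2 := by omega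
        have key : ∀ (x y : G) (hx : l₁.length + 1 + (m + 1) < (l₁ ++ x :: y :: l₂).length),
            (l₁ ++ x :: y :: l₂)[l₁.length + 1 + (m + 1)] =
              l₂[m]'(by simp at hx; omega) := by
          intro x y hx
          rw [List.getElem_append_right (by omega)]
          simp [e]
        rw [if_neg (by omega), if_neg (by omega)]
        exact (key _ _ _).trans (key _ _ _).symm

theorem BraidEquiv.of_move (l₁ l₂ : List G) (a b : G) :
    BraidEquiv (l₁ ++ a :: b :: l₂) (l₁ ++ (a * b * a⁻¹) :: a :: l₂) := by
  refine ⟨(l₁ ++ a :: b :: l₂).length, PresentedGroup.of ⟨l₁.length, by simp⟩,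
    (l₁ ++ a :: b :: l₂).get, by rw [List.ofFn_get], ?_⟩
  rw [of_smul]
  exact (ofFn_elementaryBraidPerm l₁ l₂ a b _ _ _ rfl (by rw [List.ofFn_get])).symm

/-- Braid equivalence is generated by the elementary moves. -/
theorem BraidEquiv.induction {r : List G → List G → Prop} (hr : Equivalence r)
    (hmove : ∀ (l₁ l₂ : List G) (a b : G),
      r (l₁ ++ a :: b :: l₂) (l₁ ++ (a * b * a⁻¹) :: a :: l₂))
    {l l' : List G} (h : BraidEquiv l l') : r l l' := by
  obtain ⟨n, b, g, rfl, rfl⟩ := h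
  have hb : b ∈ Subgroup.closure (Set.range (PresentedGroup.of (rels := braidRels n))) := by
    rw [PresentedGroup.closure_range_of]; trivial
  revert g
  induction hb using Subgroup.closure_induction with
  | one => intro g; rw [one_smul]; exact hr.refl _
  | mul x y _ _ hx hy => intro g; rw [mul_smul]; exact hr.trans (hy g) (hx _)
  | inv x _ hx =>
    intro g
    have := hx (x⁻¹ • g)
    rw [smul_inv_smul] at this
    exact hr.symm this
  | mem x hx =>
    obtain ⟨i, rfl⟩ := hx
    intro g
    have hi : (i : ℕ) + 1 < n := by omega
    have hg : List.ofFn g = (List.ofFn g).take i ++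
        g ⟨i, by omega⟩ :: g ⟨i + 1, hi⟩ :: (List.ofFn g).drop (i + 2) := by
      conv_lhs => rw [← List.take_append_drop i (List.ofFn g)]
      rw [List.drop_eq_getElem_cons (by simp; omega),
        List.drop_eq_getElem_cons (by simp; omega)]
      simp
    rw [of_smul, ofFn_elementaryBraidPerm _ _ _ _ n g i (by simp; omega) hg]
    conv_lhs => rw [hg]
    exact hmove _ _ _ _

theorem BraidEquiv.append_left (l : List G) {l₁ l₂ : List G} (h : BraidEquiv l₁ l₂) :
    BraidEquiv (l ++ l₁) (l ++ l₂) := by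
  refine BraidEquiv.induction (r := fun x y => BraidEquiv (l ++ x) (l ++ y))
    ⟨fun _ => .refl _, fun h => h.symm, fun h h' => h.trans h'⟩ (fun a b c d => ?_) h
  simpa using BraidEquiv.of_move (l ++ a) b c d

theorem BraidEquiv.append_right (l : List G) {l₁ l₂ : List G} (h : BraidEquiv l₁ l₂) :
    BraidEquiv (l₁ ++ l) (l₂ ++ l) := by
  refine BraidEquiv.induction (r := fun x y => BraidEquiv (x ++ l) (y ++ l))
    ⟨fun _ => .refl _, fun h => h.symm, fun h h' => h.trans h'⟩ (fun a b c d => ?_) h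
  simpa using BraidEquiv.of_move a (b ++ l) c d

theorem BraidEquiv.append {l₁ l₂ l₁' l₂' : List G} (h : BraidEquiv l₁ l₁')
    (h' : BraidEquiv l₂ l₂') : BraidEquiv (l₁ ++ l₂) (l₁' ++ l₂') :=
  (h.append_right l₂).trans (h'.append_left l₁')

theorem BraidEquiv.cons_append (a : G) (l : List G) :
    BraidEquiv (a :: l) (l.map (fun x => a * x * a⁻¹) ++ [a]) := by
  induction l with
  | nil => exact .refl _
  | cons b l ih =>
    exact (BraidEquiv.of_move [] l a b).trans (ih.append_left [a * b * a⁻¹])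

theorem BraidEquiv.append_conj (l l' : List G) :
    BraidEquiv (l ++ l') (l'.map (fun x => l.prod * x * l.prod⁻¹) ++ l) := by
  induction l generalizing l' with
  | nil => simpa using BraidEquiv.refl l'
  | cons a l ih =>
    have h1 := (ih l').append_left [a]
    have h2 := (BraidEquiv.cons_append a (l'.map (fun x => l.prod * x * l.prod⁻¹))).append_right l
    have h3 := h1.trans h2
    simpa [Function.comp_def, mul_assoc] using h3

theorem BraidEquiv.append_comm {l : List G} (l' : List G) (h : l.prod = 1) :
    BraidEquiv (l ++ l') (l' ++ l) := by
  simpa [h] using BraidEquiv.append_conj l l'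

end Action

/-! ### The monoid and the ring of components -/

section Components

variable {G : Type*} [Group G]

open Classical in
/-- The number of items of the tuple `l` which lie in the conjugacy class `c`. -/
def multidiscriminant (l : List G) (c : ConjClasses G) : ℕ :=
  l.countP (fun g => decide (g ∈ c.carrier))

/-- `l` is a tuple of length `n * |ξ|` with multidiscriminant `n ξ` and product `1`. -/
structure IsComponentTuple (D : Finset (ConjClasses G)) (ξ : D → ℕ) (n : ℕ) (l : List G) :
    Prop where
  length_eq : l.length = n * ∑ c, ξ c
  multidiscriminant_eq : ∀ c : D, multidiscriminant l c = n * ξ c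
  prod_eq_one : l.prod = 1

theorem IsComponentTuple.append {D : Finset (ConjClasses G)} {ξ : D → ℕ} {n m : ℕ}
    {l l' : List G} (h : IsComponentTuple D ξ n l) (h' : IsComponentTuple D ξ m l') :
    IsComponentTuple D ξ (n + m) (l ++ l') where
  length_eq := by rw [List.length_append, h.length_eq, h'.length_eq, add_mul]
  multidiscriminant_eq c := by
    have h1 := h.multidiscriminant_eq c
    have h2 := h'.multidiscriminant_eq c
    simp only [multidiscriminant] at h1 h2 ⊢
    rw [List.countP_append, h1, h2, add_mul]
  prod_eq_one := by rw [List.prod_append, h.prod_eq_one, h'.prod_eq_one, one_mul]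

theorem IsComponentTuple.nil (D : Finset (ConjClasses G)) (ξ : D → ℕ) :
    IsComponentTuple D ξ 0 [] :=
  ⟨by simp, fun c => by simp [multidiscriminant], by simp⟩

/-- The pairs of a degree `n` and a tuple of that degree. -/
abbrev ComponentTuple (D : Finset (ConjClasses G)) (ξ : D → ℕ) : Type _ :=
  {p : ℕ × List G // IsComponentTuple D ξ p.1 p.2}

/-- Equality of degrees together with braid equivalence. -/
instance componentSetoid (D : Finset (ConjClasses G)) (ξ : D → ℕ) :
    Setoid (ComponentTuple D ξ) where
  r x y := x.1.1 = y.1.1 ∧ BraidEquiv x.1.2 y.1.2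
  iseqv := ⟨fun _ => ⟨rfl, .refl _⟩, fun h => ⟨h.1.symm, h.2.symm⟩,
    fun h h' => ⟨h.1.trans h'.1, h.2.trans h'.2⟩⟩

/-- The graded monoid of components: its elements of degree `n` are the braid group orbits of
tuples of length `n * |ξ|`, of multidiscriminant `n ξ` and of product `1`. -/
def Comp (D : Finset (ConjClasses G)) (ξ : D → ℕ) : Type _ :=
  Quotient (componentSetoid D ξ)

/-- The product of components is induced by concatenation of tuples. -/
instance (D : Finset (ConjClasses G)) (ξ : D → ℕ) : CommMonoid (Comp D ξ) where
  mul := Quotient.map₂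
    (fun x y => ⟨(x.1.1 + y.1.1, x.1.2 ++ y.1.2), x.2.append y.2⟩)
    (fun _ _ h _ _ h' => ⟨congrArg₂ (· + ·) h.1 h'.1, h.2.append h'.2⟩)
  one := Quotient.mk _ ⟨(0, []), .nil D ξ⟩
  mul_assoc := by
    rintro ⟨x⟩ ⟨y⟩ ⟨z⟩
    refine Quotient.sound ⟨add_assoc _ _ _, ?_⟩
    change BraidEquiv ((x.1.2 ++ y.1.2) ++ z.1.2) (x.1.2 ++ (y.1.2 ++ z.1.2))
    rw [List.append_assoc]
    exact .refl _
  one_mul := by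
    rintro ⟨x⟩
    exact Quotient.sound ⟨zero_add _, .refl _⟩
  mul_one := by
    rintro ⟨x⟩
    refine Quotient.sound ⟨add_zero _, ?_⟩
    change BraidEquiv (x.1.2 ++ []) x.1.2
    rw [List.append_nil]
    exact .refl _
  mul_comm := by
    rintro ⟨x⟩ ⟨y⟩
    exact Quotient.sound ⟨add_comm _ _, .append_comm _ x.2.prod_eq_one⟩

/-- The ring of components `R(G, ξ)` over `k`: the monoid ring of the monoid of components. -/
abbrev RingOfComponents (k : Type*) [Field k] (D : Finset (ConjClasses G)) (ξ : D → ℕ) : Type _ :=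
  MonoidAlgebra k (Comp D ξ)

/-! ### `D`-generated subgroups and splitting numbers -/

/-- `H` intersects every conjugacy class in `D`. -/
def MeetsAll (D : Finset (ConjClasses G)) (H : Subgroup G) : Prop :=
  ∀ c ∈ D, ((H : Set G) ∩ c.carrier).Nonempty

/-- `H` is `D`-generated: it is trivial, or it intersects every class in `D` and is generated by
its elements which lie in the classes in `D`. -/
def IsDGenerated (D : Finset (ConjClasses G)) (H : Subgroup G) : Prop :=
  H = ⊥ ∨ (MeetsAll D H ∧ H = Subgroup.closure (⋃ c ∈ D, (c.carrier ∩ (H : Set G))))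

/-- `D_H`: the conjugacy classes of the group `H` which are contained in some class in `D`. -/
def classesIn (D : Finset (ConjClasses G)) (H : Subgroup G) : Set (ConjClasses H) :=
  {c' | ∃ c ∈ D, (Subtype.val : H → G) '' c'.carrier ⊆ c.carrier}

/-- The splitting number `Ω_D(H) = |D_H| - |D|`, meaningful when `H` intersects every class
in `D`. -/
def splittingNumber (D : Finset (ConjClasses G)) (H : Subgroup G) : ℤ :=
  ((classesIn D H).ncard : ℤ) - (D.card : ℤ)

end Components

end HurwitzComponents

end

/-!
The Krull dimension is computed from the faces of the monoid of components, that is, the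
submonoids closed under taking factors.

Upper bound. A chain of primes of length `l` starting at `P` gives `l` algebraically independent
elements in the domain `k[Comp] / P` (`exists_algebraicIndependent_of_chain`), and, since the
images of components generate this algebra, these elements can be taken to be images of
components. The components outside `P` are closed under products and factors; one of them, `z`,
generates a largest subgroup `H`, and then all of them have entries in `H`. Unless there are
no independent components at all, `z` can be taken of positive degree, so that `H` is
`D`-generated and meets all classes in `D`. The degree and the numbers of entries in the classes of
`H` take values in a lattice of rank `Ω_D(H) + 1`
(`IsComponentTuple.map_mk_perm`, `splittingNumber_eq_natCard`). The essential point is that, next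
to `z`, tuples with given class counts fall into a bounded number of braid orbits
(`exists_pigeonhole_bound`): a tuple of product `1` next to `z` may be conjugated by elements
of `H` (`BraidEquiv.append_map_conj`), and a long tuple contains some element `|H|` times, so that
up to a remainder of bounded length it is a product of blocks depending only on conjugacy
classes. Hence two monomials in components with the same exponents have images with a common
power in the domain, and there are at most `Ω_D(H) + 1` independent components
(`card_le_of_algebraicIndependent`).

Lower bound. For a subgroup `H` meeting all classes in `D`, killing the components with entries
not in `H` and recording degree and class counts of the others defines a homomorphism from
`k[Comp]` to a polynomial ring in `Ω_D(H) + 1` variables. Its image contains enough monomials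
(`exists_component_of_section`) for the ideals generated by the `Xᵢ - 1`, with `i` in an
increasing sequence of subsets of the variables, to have distinct preimages
(`card_le_ringKrullDim_monoidAlgebra`).
-/

namespace HurwitzComponents

/-! ### Braid equivalence of tuples in a finite group -/

section BraidLists

variable {G : Type*} [Group G]

theorem BraidEquiv.of_eq {l l' : List G} (h : l = l') : BraidEquiv l l' :=
  h ▸ .refl l

theorem BraidEquiv.prod_eq {l l' : List G} (h : BraidEquiv l l') : l.prod = l'.prod := by
  refine BraidEquiv.induction (r := fun x y => x.prod = y.prod)
    ⟨fun _ => rfl, Eq.symm, Eq.trans⟩ (fun l₁ l₂ a b => ?_) h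
  simp [mul_assoc]

theorem BraidEquiv.map_mk_perm {l l' : List G} (h : BraidEquiv l l') :
    (l.map ConjClasses.mk).Perm (l'.map ConjClasses.mk) := by
  refine BraidEquiv.induction
    (r := fun x y => (x.map ConjClasses.mk).Perm (y.map ConjClasses.mk))
    ⟨fun _ => .refl _, .symm, .trans⟩ (fun l₁ l₂ a b => ?_) h
  have : ConjClasses.mk (a * b * a⁻¹) = ConjClasses.mk b :=
    ConjClasses.mk_eq_mk_iff_isConj.2 (isConj_iff.2 ⟨a, rfl⟩).symm
  simp only [List.map_append, List.map_cons, this]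
  exact (List.Perm.swap _ _ _).append_left _

theorem BraidEquiv.map {H : Type*} [Group H] (f : G →* H) {l l' : List G}
    (h : BraidEquiv l l') : BraidEquiv (l.map f) (l'.map f) := by
  refine BraidEquiv.induction (r := fun x y => BraidEquiv (x.map f) (y.map f))
    ⟨fun _ => .refl _, .symm, .trans⟩ (fun l₁ l₂ a b => ?_) h
  simpa using BraidEquiv.of_move (l₁.map f) (l₂.map f) (f a) (f b)

/-- The subgroup generated by the entries of a tuple does not change under braids. -/
theorem BraidEquiv.closure_eq {l l' : List G} (h : BraidEquiv l l') :
    Subgroup.closure {g | g ∈ l} = Subgroup.closure {g | g ∈ l'} := by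
  refine BraidEquiv.induction
    (r := fun x y => Subgroup.closure {g | g ∈ x} = Subgroup.closure {g | g ∈ y})
    ⟨fun _ => rfl, Eq.symm, Eq.trans⟩ (fun l₁ l₂ a b => ?_) h
  apply le_antisymm <;> rw [Subgroup.closure_le] <;> intro g hg
  · have ha : a ∈ Subgroup.closure {g | g ∈ l₁ ++ (a * b * a⁻¹) :: a :: l₂} :=
      Subgroup.subset_closure (by simp)
    have hb : a * b * a⁻¹ ∈ Subgroup.closure {g | g ∈ l₁ ++ (a * b * a⁻¹) :: a :: l₂} :=
      Subgroup.subset_closure (by simp)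
    simp only [Set.mem_ofPred_eq, List.mem_append, List.mem_cons] at hg
    rcases hg with hg | rfl | rfl | hg
    · exact Subgroup.subset_closure (by simp [hg])
    · exact ha
    · have := mul_mem (mul_mem (inv_mem ha) hb) ha
      simpa [mul_assoc] using this
    · exact Subgroup.subset_closure (by simp [hg])
  · have ha : a ∈ Subgroup.closure {g | g ∈ l₁ ++ a :: b :: l₂} :=
      Subgroup.subset_closure (by simp)
    have hb : b ∈ Subgroup.closure {g | g ∈ l₁ ++ a :: b :: l₂} :=
      Subgroup.subset_closure (by simp)
    simp only [Set.mem_ofPred_eq, List.mem_append, List.mem_cons] at hg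
    rcases hg with hg | rfl | rfl | hg
    · exact Subgroup.subset_closure (by simp [hg])
    · exact mul_mem (mul_mem ha hb) (inv_mem ha)
    · exact ha
    · exact Subgroup.subset_closure (by simp [hg])

theorem prod_map_conj (h : G) {l : List G} (hl : l.prod = 1) :
    (l.map (fun x => h * x * h⁻¹)).prod = 1 := by
  rw [show (fun x => h * x * h⁻¹) = MulAut.conj h from rfl, ← map_list_prod, hl, map_one]

/-- A tuple of product `1` next to a tuple of product `1` generating the group can be conjugated
by any group element: carrying it past a single entry `a` of the generating tuple conjugates it
by `a`, and it commutes with everything else. -/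
theorem BraidEquiv.append_map_conj [Finite G] {z l : List G} (hzp : z.prod = 1)
    (hz : Subgroup.closure {g | g ∈ z} = ⊤) (hl : l.prod = 1) (h : G) :
    BraidEquiv (z ++ l) (z ++ l.map (fun x => h * x * h⁻¹)) := by
  have hh : h ∈ Subgroup.closure {g | g ∈ z} := hz ▸ Subgroup.mem_top h
  induction hh using Subgroup.closure_induction generalizing l with
  | one => simpa using BraidEquiv.refl _
  | mul x y _ _ hx hy =>
    have := (hy hl).trans (hx (prod_map_conj y hl))
    simpa [Function.comp_def, mul_assoc] using this
  | inv x _ hx =>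
    have := (hx (prod_map_conj x⁻¹ hl)).symm
    simpa [Function.comp_def, mul_assoc] using this
  | mem a ha =>
    obtain ⟨z₁, z₂, rfl⟩ := List.append_of_mem (show a ∈ z from ha)
    have h1 : BraidEquiv ((z₁ ++ a :: z₂) ++ l) (z₁ ++ (([a] ++ l) ++ z₂)) := by
      have := (BraidEquiv.append_comm z₂ hl).symm.append_left (z₁ ++ [a])
      simpa using this
    have h2 : BraidEquiv ([a] ++ l) (l.map (fun x => a * x * a⁻¹) ++ [a]) := by
      simpa using BraidEquiv.append_conj [a] l
    have h3 := ((h2.append_right z₂).append_left z₁)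
    have h4 := (BraidEquiv.append_comm (a :: z₂) (prod_map_conj a hl)).append_left z₁
    refine h1.trans (h3.trans ?_)
    simpa using h4

/-- Copies of an entry can be collected at the beginning of a tuple. -/
theorem BraidEquiv.exists_replicate_append [DecidableEq G] (g : G) (n : ℕ) {l : List G}
    (h : n ≤ l.count g) : ∃ l', BraidEquiv l (List.replicate n g ++ l') := by
  induction n generalizing l with
  | zero => exact ⟨l, by simpa using BraidEquiv.refl l⟩
  | succ n ih =>
    have hg : g ∈ l := List.count_pos_iff.1 (by omega)
    obtain ⟨l₁, l₂, rfl⟩ := List.append_of_mem hg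
    have h1 : BraidEquiv (l₁ ++ g :: l₂)
        ([g] ++ (l₁.map (fun x => g⁻¹ * x * g) ++ l₂)) := by
      have := (BraidEquiv.append_conj [g] (l₁.map (fun x => g⁻¹ * x * g))).symm.append_right l₂
      simpa [Function.comp_def, mul_assoc] using this
    have hc : (l₁.map (fun x => g⁻¹ * x * g)).count g = l₁.count g := by
      have hinj : Function.Injective fun x => g⁻¹ * x * g := fun x y hxy => by simpa using hxy
      simpa using List.count_map_of_injective l₁ _ hinj g
    obtain ⟨l', hl'⟩ := ih (l := l₁.map (fun x => g⁻¹ * x * g) ++ l₂) (by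
      rw [List.count_append, hc]
      rw [List.count_append, List.count_cons_self] at h
      omega)
    exact ⟨l', h1.trans (by simpa [List.replicate_succ] using hl'.append_left [g])⟩

/-- A chosen element of a conjugacy class. -/
noncomputable def classRep (c : ConjClasses G) : G := Quotient.out c

theorem mk_classRep (c : ConjClasses G) : ConjClasses.mk (classRep c) = c :=
  Quotient.out_eq c

/-- The tuple in which, for each entry `c` of the given list of conjugacy classes, a chosen
element of `c` is repeated `|G|` times. Each of these blocks has product `1`. -/
noncomputable def powerTuple (cs : List (ConjClasses G)) : List G :=
  cs.flatMap fun c => List.replicate (Nat.card G) (classRep c)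

theorem prod_replicate_card (g : G) : (List.replicate (Nat.card G) g).prod = 1 := by
  simp [List.prod_replicate]

theorem powerTuple_prod (cs : List (ConjClasses G)) : (powerTuple cs).prod = 1 := by
  induction cs with
  | nil => rfl
  | cons c cs ih =>
    simp only [powerTuple, List.flatMap_cons, List.prod_append] at ih ⊢
    rw [ih, prod_replicate_card, one_mul]

theorem powerTuple_perm {cs cs' : List (ConjClasses G)} (h : cs.Perm cs') :
    BraidEquiv (powerTuple cs) (powerTuple cs') := by
  induction h with
  | nil => exact .refl _
  | cons c _ ih => exact ih.append_left _
  | swap c d cs =>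
    simp only [powerTuple, List.flatMap_cons, ← List.append_assoc]
    exact (BraidEquiv.append_comm _ (prod_replicate_card _)).append_right _
  | trans _ _ ih ih' => exact ih.trans ih'

theorem countP_powerTuple (p : ConjClasses G → Bool) (cs : List (ConjClasses G)) :
    ((powerTuple cs).map ConjClasses.mk).countP p = Nat.card G * cs.countP p := by
  induction cs with
  | nil => rfl
  | cons d cs ih =>
    simp only [powerTuple, List.flatMap_cons, List.map_append, List.map_replicate,
      List.countP_append, mk_classRep, List.countP_replicate, List.countP_cons] at ih ⊢
    rw [ih, mul_add, add_comm]
    congr 1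
    split_ifs <;> simp

/-- In the presence of a generating tuple of product `1`, a tuple of product `1` can be rewritten
as a product of `|G|`-fold repetitions of chosen class representatives and a remainder of bounded
length: a long tuple contains some element `|G|` times. -/
theorem exists_powerTuple_append [Finite G] {z : List G} (hzp : z.prod = 1)
    (hz : Subgroup.closure {g | g ∈ z} = ⊤) {l : List G} (hl : l.prod = 1) :
    ∃ (cs : List (ConjClasses G)) (s : List G), s.length ≤ Nat.card G * Nat.card G ∧
      BraidEquiv (z ++ l) (z ++ (powerTuple cs ++ s)) ∧
      (l.map ConjClasses.mk).Perm ((powerTuple cs ++ s).map ConjClasses.mk) := by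
  classical
  cases nonempty_fintype G
  induction hn : l.length using Nat.strong_induction_on generalizing l with
  | _ n ih =>
    subst hn
    by_cases hlen : l.length ≤ Nat.card G * Nat.card G
    · exact ⟨[], l, hlen, .refl _, .refl _⟩
    · obtain ⟨g, hg⟩ : ∃ g, Nat.card G ≤ l.count g := by
        by_contra! hcon
        apply hlen
        have h1 : l.length = ∑ g : G, l.count g := by
          have := Multiset.sum_count_eq_card (s := Finset.univ) (m := (l : Multiset G))
            (fun a _ => Finset.mem_univ a)
          simpa using this.symm
        rw [h1]
        refine (Finset.sum_le_card_nsmul _ _ (Nat.card G) fun g _ => (hcon g).le).trans ?_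
        simp [Nat.card_eq_fintype_card]
      obtain ⟨l', hl'⟩ := BraidEquiv.exists_replicate_append g _ hg
      have hp' : l'.prod = 1 := by
        have := hl'.prod_eq
        rw [hl, List.prod_append, prod_replicate_card, one_mul] at this
        exact this.symm
      have hperm := hl'.map_mk_perm
      have hlt : l'.length < l.length := by
        have := hperm.length_eq
        have hpos : 0 < Nat.card G := Nat.card_pos
        simp only [List.length_map, List.length_append, List.length_replicate] at this
        omega
      obtain ⟨cs, s, hs, hb, hm⟩ := ih _ hlt hp' rfl
      set r : List G := List.replicate (Nat.card G) (classRep (ConjClasses.mk g)) with hr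
      have hrp : r.prod = 1 := prod_replicate_card _
      obtain ⟨x, hx⟩ : ∃ x, x * g * x⁻¹ = classRep (ConjClasses.mk g) :=
        isConj_iff.1 (ConjClasses.mk_eq_mk_iff_isConj.1 (mk_classRep (ConjClasses.mk g)).symm)
      have h1 : BraidEquiv (z ++ List.replicate (Nat.card G) g) (z ++ r) := by
        have := BraidEquiv.append_map_conj hzp hz (prod_replicate_card g) x
        simpa [hx, hr] using this
      have hcs : powerTuple (ConjClasses.mk g :: cs) = r ++ powerTuple cs := rfl
      refine ⟨ConjClasses.mk g :: cs, s, hs, ?_, ?_⟩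
      · have h2 : BraidEquiv (z ++ l) (z ++ r ++ l') := by
          refine (hl'.append_left z).trans ?_
          simpa using h1.append_right l'
        have h3 : ∀ t : List G, BraidEquiv (z ++ r ++ t) (r ++ (z ++ t)) := fun t => by
          simpa using (BraidEquiv.append_comm r hzp).append_right t
        rw [hcs, List.append_assoc, ← List.append_assoc z]
        exact h2.trans ((h3 l').trans ((hb.append_left r).trans (h3 _).symm))
      · refine hperm.trans ?_
        rw [hcs, List.append_assoc, List.map_append, List.map_append]
        refine List.Perm.append ?_ hm
        simp [hr, mk_classRep]

/-- There is a bound, depending only on the group, on the number of classes of tuples of product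
`1` with prescribed conjugacy classes of entries, up to braids in the presence of a generating
tuple `z` of product `1`. -/
theorem exists_pigeonhole_bound (G : Type*) [Group G] [Finite G] :
    ∃ J : ℕ, ∀ z : List G, z.prod = 1 → Subgroup.closure {g | g ∈ z} = ⊤ →
      ∀ y : Fin (J + 1) → List G, (∀ i, (y i).prod = 1) →
        (∀ i j, ((y i).map ConjClasses.mk).Perm ((y j).map ConjClasses.mk)) →
        ∃ i j, i < j ∧ BraidEquiv (z ++ y i) (z ++ y j) := by
  classical
  have hfin : {s : List G | s.length ≤ Nat.card G * Nat.card G}.Finite :=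
    List.finite_length_le G _
  refine ⟨hfin.toFinset.card, fun z hzp hz y hy hperm => ?_⟩
  choose cs s hs hb hm using fun i => exists_powerTuple_append hzp hz (hy i)
  obtain ⟨i, _, j, _, hij, hsij⟩ := Finset.exists_ne_map_eq_of_card_lt_of_maps_to
    (s := Finset.univ) (t := hfin.toFinset) (f := s) (by simp) (fun i _ => by simpa using hs i)
  have key : BraidEquiv (z ++ y i) (z ++ y j) := by
    have hp : (cs i).Perm (cs j) := by
      have h1 := ((hm i).symm.trans (hperm i j)).trans (hm j)
      rw [hsij, List.map_append, List.map_append, List.perm_append_right_iff] at h1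
      rw [List.perm_iff_count] at h1 ⊢
      intro c
      have := h1 c
      rw [List.count_eq_countP, List.count_eq_countP, countP_powerTuple, countP_powerTuple] at this
      exact Nat.eq_of_mul_eq_mul_left Nat.card_pos this
    refine (hb i).trans (.trans ?_ (hb j).symm)
    rw [hsij]
    exact ((powerTuple_perm hp).append_right _).append_left z
  rcases lt_or_gt_of_ne hij with h | h
  · exact ⟨i, j, h, key⟩
  · exact ⟨j, i, h, key.symm⟩

end BraidLists

/-! ### Chains of primes, and dimensions of monoid rings -/

section Algebra

open MvPolynomial

/-- A chain of primes `p₀ < ⋯ < pₗ` yields `l` elements which are algebraically independent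
modulo `p₀`: if `x₂, …, xₗ` are independent modulo `p₁` and `x₁ ∈ p₁ \ p₀`, then a relation
for `x₁` over `k[x₂, …, xₗ]` modulo `p₀` may be taken with nonzero constant term, which reduces
to a relation for `x₂, …, xₗ` modulo `p₁`. -/
theorem exists_algebraicIndependent_of_chain {k R : Type*} [Field k] [CommRing R] [Algebra k R]
    (l : ℕ) (p : Fin (l + 1) → PrimeSpectrum R) (hp : StrictMono p) :
    ∃ x : Fin l → R ⧸ (p 0).asIdeal, AlgebraicIndependent k x := by
  induction l with
  | zero => exact ⟨Fin.elim0, algebraicIndependent_empty_type_iff.2 (algebraMap k _).injective⟩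
  | succ l ih =>
    let I := (p 0).asIdeal
    let J := (p (Fin.succ 0)).asIdeal
    obtain ⟨x, hx⟩ : ∃ x : Fin l → R ⧸ J, AlgebraicIndependent k x :=
      ih (fun i => p i.succ) (hp.comp Fin.strictMono_succ)
    choose y hy using fun i => Ideal.Quotient.mk_surjective (x i)
    have hIJ : I < J := hp (Fin.succ_pos 0)
    obtain ⟨a, haJ, haI⟩ := SetLike.exists_of_lt hIJ
    let f : R ⧸ I →ₐ[k] R ⧸ J := Ideal.Quotient.factorₐ k hIJ.le
    let x' : Fin l → R ⧸ I := fun i => Ideal.Quotient.mk I (y i)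
    have hfx' : f ∘ x' = x := _root_.funext fun i => hy i
    have hx' : AlgebraicIndependent k x' := AlgebraicIndependent.of_comp f (hfx' ▸ hx)
    have ha : Transcendental (Algebra.adjoin k (Set.range x')) (Ideal.Quotient.mk I a) := by
      intro halg
      have ha0 : Ideal.Quotient.mk I a ≠ 0 := fun h => haI (Ideal.Quotient.eq_zero_iff_mem.1 h)
      obtain ⟨q, hq0, hq⟩ := halg.exists_nonzero_coeff_and_aeval_eq_zero
        (mem_nonZeroDivisors_of_ne_zero ha0)
      have hfa : f (Ideal.Quotient.mk I a) = 0 := Ideal.Quotient.eq_zero_iff_mem.2 haJ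
      have h1 : f (q.coeff 0 : Algebra.adjoin k (Set.range x')) = 0 := by
        rw [← Polynomial.divX_mul_X_add q, map_add, map_mul, Polynomial.aeval_X,
          Polynomial.aeval_C] at hq
        have := congrArg f hq
        rwa [map_add, map_mul, hfa, mul_zero, zero_add, map_zero] at this
      obtain ⟨g, hg⟩ : ∃ g : MvPolynomial (Fin l) k, aeval x' g = (q.coeff 0 : R ⧸ I) :=
        (Algebra.adjoin_range_eq_range_aeval k x').le (q.coeff 0).2
      have h2 : aeval x g = 0 := by
        rw [← hfx', ← h1, ← hg]
        exact (comp_aeval_apply x' f g).symm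
      have h3 : g = 0 := hx.eq_zero_of_aeval_eq_zero g h2
      apply hq0
      apply Subtype.ext
      rw [← hg, h3, map_zero]
      rfl
    have := (hx'.option_iff_transcendental _).2 ha
    exact ⟨_, this.comp _ (finSuccEquiv l).injective⟩

/-- Algebraically independent elements in the image of a monoid homomorphism to a domain cannot
outnumber the coordinates of an additive invariant `ν` whose fibres, after multiplication by a
suitable `z`, have bounded size. Indeed, more elements than coordinates produce distinct monomials
`x`, `y` with `ν x = ν y`, and the pigeonhole principle applied to `x ^ i * y ^ (J - i)`
shows that the images of `x` and `y` have a common power. -/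
theorem card_le_of_algebraicIndependent {k A M σ κ : Type*} [Field k] [CommRing A] [IsDomain A]
    [Algebra k A] [CommMonoid M] [Finite σ] [Finite κ]
    (f : M →* A) (hf : ∀ m, f m ≠ 0) (ν : M →* Multiplicative (σ → ℕ)) (J : ℕ) (z : M)
    (hz : ∀ y : Fin (J + 1) → M, (∀ i j, ν (y i) = ν (y j)) → ∃ i j, i < j ∧ z * y i = z * y j)
    (m : κ → M) (hm : AlgebraicIndependent k (f ∘ m)) : Nat.card κ ≤ Nat.card σ := by
  classical
  cases nonempty_fintype σ
  cases nonempty_fintype κ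
  by_contra! hcard
  let v : κ → σ → ℤ := fun i s => ((ν (m i)).toAdd s : ℤ)
  have hv : ¬ LinearIndependent ℤ v := by
    intro h
    have := h.fintype_card_le_finrank
    rw [Module.finrank_fintype_fun_eq_card, ← Nat.card_eq_fintype_card,
      ← Nat.card_eq_fintype_card] at this
    omega
  obtain ⟨g, hg, i₀, hi₀⟩ := Fintype.not_linearIndependent_iff.1 hv
  let mon : (κ → ℕ) → M := fun a => ∏ i, m i ^ a i
  have hν : ∀ (a : κ → ℕ) (s : σ),
      ((ν (mon a)).toAdd s : ℤ) = ∑ i, (a i : ℤ) * ((ν (m i)).toAdd s : ℤ) := by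
    intro a s
    simp [mon, toAdd_prod]
  let p : κ → ℕ := fun i => (g i).toNat
  let q : κ → ℕ := fun i => (-g i).toNat
  have hpq : ν (mon p) = ν (mon q) := by
    apply Multiplicative.toAdd.injective
    funext s
    have h1 : ((ν (mon p)).toAdd s : ℤ) - ((ν (mon q)).toAdd s : ℤ) = 0 := by
      rw [hν, hν, ← Finset.sum_sub_distrib]
      have := congrFun hg s
      simp only [Finset.sum_apply, Pi.smul_apply, smul_eq_mul, Pi.zero_apply] at this
      rw [← this]
      refine Finset.sum_congr rfl fun i _ => ?_
      rw [← sub_mul]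
      congr 1
      simp only [p, q]
      omega
    exact_mod_cast sub_eq_zero.1 h1
  obtain ⟨i, j, hij, hzij⟩ := hz (fun i => mon p ^ (i : ℕ) * mon q ^ (J - i : ℕ)) (by
    have : ∀ i : Fin (J + 1), ν (mon p ^ (i : ℕ) * mon q ^ (J - i : ℕ)) = ν (mon q) ^ J := by
      intro i
      rw [map_mul, map_pow, map_pow, hpq, ← pow_add]
      congr 1
      omega
    intro i j
    rw [this, this])
  -- Cancel `z`, `x ^ i` and `y ^ (J - j)` in the domain.
  have hpow : f (mon p) ^ (j - i : ℕ) = f (mon q) ^ (j - i : ℕ) := by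
    have h1 := congrArg f hzij
    simp only [map_mul, map_pow] at h1
    have h2 := mul_left_cancel₀ (hf z) h1
    have e1 : (j : ℕ) = i + (j - i) := by omega
    have e2 : J - i = (j - i) + (J - j) := by omega
    rw [e2, pow_add, e1, pow_add, ← e1, mul_assoc] at h2
    have h3 := mul_left_cancel₀ (pow_ne_zero _ (hf _)) h2
    exact (mul_right_cancel₀ (pow_ne_zero _ (hf _)) h3).symm
  have hmon : ∀ a : κ → ℕ, f (mon a) ^ (j - i : ℕ) = aeval (f ∘ m)
      (monomial (Finsupp.equivFunOnFinite.symm fun t => a t * (j - i : ℕ)) (1 : k)) := by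
    intro a
    rw [aeval_monomial, map_one, one_mul, Finsupp.prod_fintype _ _ (by simp)]
    simp [mon, Finset.prod_pow, pow_mul]
  rw [hmon, hmon] at hpow
  have h4 := monomial_left_injective (one_ne_zero (α := k)) (hm hpow)
  have h5 := DFunLike.congr_fun h4 i₀
  simp only [Finsupp.equivFunOnFinite_symm_apply_apply, p, q] at h5
  have h6 := Nat.eq_of_mul_eq_mul_right (by omega : 0 < (j - i : ℕ)) h5
  omega

/-- An upper bound for the Krull dimension of a monoid ring, from bounds on the number of
algebraically independent monomials in its residue domains. -/
theorem ringKrullDim_monoidAlgebra_le {k M : Type*} [Field k] [CommMonoid M] (d : ℕ)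
    (h : ∀ (P : Ideal (MonoidAlgebra k M)) [P.IsPrime] (l : ℕ) (m : Fin l → M),
      AlgebraicIndependent k (fun i => Ideal.Quotient.mk P (MonoidAlgebra.of k M (m i))) →
        l ≤ d) :
    ringKrullDim (MonoidAlgebra k M) ≤ d := by
  refine iSup_le fun p => ?_
  obtain ⟨x, hx⟩ := exists_algebraicIndependent_of_chain (k := k) p.length p.toFun p.strictMono
  set P := (p.toFun 0).asIdeal
  let f : M → MonoidAlgebra k M ⧸ P := fun m => Ideal.Quotient.mk P (MonoidAlgebra.of k M m)
  have htop : Algebra.adjoin k (Set.range f) = ⊤ := by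
    have h1 : Algebra.adjoin k (Set.range (MonoidAlgebra.of k M)) = ⊤ := by
      rw [eq_top_iff]
      rintro a -
      exact MonoidAlgebra.mem_adjoin_support a |> Algebra.adjoin_mono (by
        rintro _ ⟨b, _, rfl⟩; exact ⟨b, rfl⟩)
    have h2 : Set.range f = Ideal.Quotient.mkₐ k P '' Set.range (MonoidAlgebra.of k M) := by
      rw [← Set.range_comp]; rfl
    rw [h2, ← AlgHom.map_adjoin, h1, Algebra.map_top, AlgHom.range_eq_top]
    exact Ideal.Quotient.mkₐ_surjective k P
  have : Algebra.IsAlgebraic (Algebra.adjoin k (Set.range f)) (MonoidAlgebra k M ⧸ P) := by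
    refine ⟨fun a => ?_⟩
    have ha : a ∈ Algebra.adjoin k (Set.range f) := htop ▸ Algebra.mem_top
    exact isAlgebraic_algebraMap (⟨a, ha⟩ : Algebra.adjoin k (Set.range f))
  have : FaithfulSMul k (MonoidAlgebra k M ⧸ P) :=
    (faithfulSMul_iff_algebraMap_injective _ _).2 (algebraMap k _).injective
  obtain ⟨t, ht, hb⟩ := exists_isTranscendenceBasis_subset (R := k) (Set.range f)
  have hle : (p.length : Cardinal) ≤ Cardinal.mk t := by
    rw [hb.cardinalMk_eq_trdeg]
    have := hx.lift_cardinalMk_le_trdeg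
    simpa using this
  obtain ⟨e⟩ : Nonempty (Fin p.length ↪ t) := by
    rw [← Cardinal.lift_mk_le']
    simpa using hle
  choose m hm using fun i => ht (e i).2
  have hind : AlgebraicIndependent k (fun i => f (m i)) := by
    have := hb.1.comp e e.injective
    convert this using 1
    funext i
    exact hm i
  exact_mod_cast h P p.length m hind

/-- A lower bound for the Krull dimension of `k[M]`. Let `F` be a face of `M`, with a
homomorphism `ν` from `F` to `ℕ^(Option τ)`, an element `t` whose only nonzero exponent is the one
at `none`, and elements `u i` whose exponents differ from those of `t` exactly at `i`. Sending
the elements outside `F` to `0` gives a homomorphism from `k[M]` to the polynomial ring in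
`Option τ`; the preimages of the prime ideals generated by the `Xₛ - 1`, for `s` in a set of
variables, are strictly increasing in this set. -/
theorem card_le_ringKrullDim_monoidAlgebra {k M τ : Type*} [Field k] [CommMonoid M] [Finite τ]
    (F : Submonoid M) (hF : ∀ x y, x * y ∈ F → x ∈ F ∧ y ∈ F)
    (ν : F →* Multiplicative (Option τ → ℕ)) (t : F) (u : τ → F)
    (ht : (ν t).toAdd none ≠ 0) (ht' : ∀ i, (ν t).toAdd (some i) = 0)
    (hu : ∀ i, (ν (u i)).toAdd none = (ν t).toAdd none)
    (hu₁ : ∀ i, (ν (u i)).toAdd (some i) ≠ 0)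
    (hu₂ : ∀ i j, j ≠ i → (ν (u i)).toAdd (some j) = 0) :
    ((Nat.card (Option τ) : ℕ) : WithBot ℕ∞) ≤ ringKrullDim (MonoidAlgebra k M) := by
  classical
  cases nonempty_fintype τ
  let ψ : F →* MvPolynomial (Option τ) k :=
    { toFun := fun x => ∏ s, X s ^ (ν x).toAdd s
      map_one' := by simp
      map_mul' := fun x y => by simp [pow_add, Finset.prod_mul_distrib] }
  let χ : M →* MvPolynomial (Option τ) k :=
    { toFun := fun x => if h : x ∈ F then ψ ⟨x, h⟩ else 0
      map_one' := by rw [dif_pos F.one_mem]; exact map_one ψ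
      map_mul' := fun x y => by
        by_cases hx : x ∈ F
        · by_cases hy : y ∈ F
          · rw [dif_pos (F.mul_mem hx hy), dif_pos hx, dif_pos hy, ← map_mul]; rfl
          · rw [dif_neg hy, mul_zero, dif_neg fun h => hy (hF x y h).2]
        · rw [dif_neg hx, zero_mul, dif_neg fun h => hx (hF x y h).1] }
  have hχ : ∀ x : F, χ x = ψ x := fun x => dif_pos x.2
  let φ : MonoidAlgebra k M →ₐ[k] MvPolynomial (Option τ) k := MonoidAlgebra.lift k _ M χ
  let ev : Finset (Option τ) → MvPolynomial (Option τ) k →ₐ[k] MvPolynomial (Option τ) k :=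
    fun S => aeval fun s => if s ∈ S then 1 else X s
  let Q : Finset (Option τ) → PrimeSpectrum (MonoidAlgebra k M) := fun S =>
    ⟨RingHom.ker ((ev S).comp φ : MonoidAlgebra k M →+* MvPolynomial (Option τ) k),
      RingHom.ker_isPrime _⟩
  have hev : ∀ S T, S ⊆ T → (ev T).comp (ev S) = ev T := by
    intro S T hST
    apply MvPolynomial.algHom_ext
    intro s
    by_cases hs : s ∈ S
    · simp [ev, hs, hST hs]
    · simp [ev, hs]
  have hφ : ∀ (S) (x : F), (ev S).comp φ (MonoidAlgebra.of k M x) =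
      ∏ s, (if s ∈ S then 1 else X s : MvPolynomial (Option τ) k) ^ (ν x).toAdd s := by
    intro S x
    rw [AlgHom.comp_apply]
    have : φ (MonoidAlgebra.of k M x) = ψ x := by
      simp only [φ, MonoidAlgebra.lift_of, hχ]
    rw [this]
    simp [ψ, ev]
  have hmono : StrictMono Q := by
    intro S T hST
    refine lt_of_le_of_ne ?_ ?_
    · intro a ha
      have ha' : (ev S).comp φ a = 0 := ha
      change (ev T).comp φ a = 0
      rw [← hev S T hST.subset, AlgHom.comp_assoc, AlgHom.comp_apply, ha', map_zero]
    · intro hQ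
      have hQ' : ∀ a b, (ev T).comp φ a = (ev T).comp φ b → (ev S).comp φ a = (ev S).comp φ b := by
        intro a b hab
        have h1 : a - b ∈ (Q T).asIdeal := by
          change (ev T).comp φ (a - b) = 0
          rw [map_sub, hab, sub_self]
        rw [← hQ] at h1
        have h2 : (ev S).comp φ (a - b) = 0 := h1
        rwa [map_sub, sub_eq_zero] at h2
      obtain ⟨i, hiT, hiS⟩ := Finset.exists_of_ssubset hST
      -- Setting all variables except `i` to `1` separates the two images.
      let δ : MvPolynomial (Option τ) k →ₐ[k] Polynomial k :=
        aeval fun s => if s = i then Polynomial.X else 1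
      have hδ : ∀ x : F, δ (∏ s, (if s ∈ S then 1 else X s : MvPolynomial (Option τ) k) ^
          (ν x).toAdd s) = Polynomial.X ^ (ν x).toAdd i := by
        intro x
        rw [map_prod, Finset.prod_eq_single i]
        · simp [δ, hiS]
        · intro s _ hs
          by_cases hsS : s ∈ S <;> simp [δ, hs, hsS]
        · simp
      have key : ∀ x y : F, (∀ s ∉ T, (ν x).toAdd s = (ν y).toAdd s) →
          (ν x).toAdd i = (ν y).toAdd i := by
        intro x y hxy
        have h1 := hQ' (MonoidAlgebra.of k M x) (MonoidAlgebra.of k M y) (by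
          rw [hφ, hφ]
          refine Finset.prod_congr rfl fun s _ => ?_
          by_cases hs : s ∈ T
          · simp [hs]
          · rw [hxy s hs])
        rw [hφ, hφ] at h1
        have h2 := congrArg δ h1
        rw [hδ, hδ] at h2
        simpa using congrArg Polynomial.natDegree h2
      rcases i with _ | i
      · apply ht
        have := key t 1 (fun s hs => by
          rcases s with _ | s
          · exact absurd hiT hs
          · simp [ht'])
        simpa using this
      · apply hu₁ i
        have := key (u i) t (fun s hs => by
          rcases s with _ | s
          · exact hu i
          · rw [hu₂ i s (by rintro rfl; exact hs hiT), ht'])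
        rw [this, ht']
  let e := Finite.equivFin (Option τ)
  let c : Fin (Nat.card (Option τ) + 1) → Finset (Option τ) :=
    fun j => Finset.univ.filter fun s => (e s : ℕ) < j
  have hc : StrictMono c := by
    intro a b hab
    refine (Finset.ssubset_iff_of_subset fun s hs => ?_).2
      ⟨e.symm ⟨a, by omega⟩, by simpa [c] using hab, by simp [c]⟩
    simp only [c, Finset.mem_filter, Finset.mem_univ, true_and] at hs ⊢
    exact hs.trans hab
  exact Order.le_krullDim_iff.2 ⟨LTSeries.mk _ (Q ∘ c) (hmono.comp hc), rfl⟩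

end Algebra

/-! ### Class counts relative to a subgroup -/

section ClassCount

variable {G : Type*} [Group G]

theorem closure_append (l l' : List G) : Subgroup.closure {g | g ∈ l ++ l'} =
    Subgroup.closure {g | g ∈ l} ⊔ Subgroup.closure {g | g ∈ l'} := by
  rw [← Subgroup.closure_union]
  congr 1
  ext g
  simp

theorem exists_map_val_eq {H : Subgroup G} {l : List G}
    (hl : Subgroup.closure {g | g ∈ l} ≤ H) : ∃ l' : List H, l'.map Subtype.val = l :=
  ⟨l.pmap Subtype.mk fun _ hg => hl (Subgroup.subset_closure hg), by simp [List.map_pmap]⟩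

theorem closure_map_val_le {H : Subgroup G} (l : List H) :
    Subgroup.closure {g | g ∈ l.map Subtype.val} ≤ H := by
  rw [Subgroup.closure_le]
  intro g hg
  obtain ⟨h, _, rfl⟩ := List.mem_map.1 hg
  exact h.2

theorem closure_eq_top_of_map_val {H : Subgroup G} {l : List H}
    (hl : Subgroup.closure {g | g ∈ l.map Subtype.val} = H) :
    Subgroup.closure {h | h ∈ l} = ⊤ := by
  apply Subgroup.map_injective H.subtype_injective
  rw [MonoidHom.map_closure, ← MonoidHom.range_eq_map, Subgroup.range_subtype]
  convert hl using 2
  ext g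
  simp

open Classical in
/-- The number of entries of the tuple `l` which lie in the conjugacy class `c'` of the
subgroup `H`. -/
noncomputable def classCount (H : Subgroup G) (c' : ConjClasses H) (l : List G) : ℕ :=
  l.countP fun g => decide (∃ h : H, (h : G) = g ∧ ConjClasses.mk h = c')

open Classical in
theorem classCount_map_val {H : Subgroup G} (c' : ConjClasses H) (l : List H) :
    classCount H c' (l.map Subtype.val) = (l.map ConjClasses.mk).count c' := by
  rw [classCount, List.count_eq_countP, List.countP_map, List.countP_map]
  congr 1
  funext h
  rw [Bool.eq_iff_iff]
  simp

open Classical in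
theorem multidiscriminant_map_val {H : Subgroup G} (c : ConjClasses G) (l : List H) :
    multidiscriminant (l.map Subtype.val) c =
      (l.map ConjClasses.mk).countP fun c' => decide (ConjClasses.map H.subtype c' = c) := by
  rw [multidiscriminant, List.countP_map, List.countP_map]
  congr 1
  funext h
  simp only [Function.comp_apply, ConjClasses.mem_carrier_iff_mk_eq]
  rfl

theorem BraidEquiv.classCount_eq {H : Subgroup G} (c' : ConjClasses H) {l l' : List G}
    (h : BraidEquiv l l') (hl : Subgroup.closure {g | g ∈ l} ≤ H) :
    classCount H c' l = classCount H c' l' := by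
  classical
  let r : List G → List G → Prop := fun x y =>
    Subgroup.closure {g | g ∈ x} = Subgroup.closure {g | g ∈ y} ∧
      (Subgroup.closure {g | g ∈ x} ≤ H → classCount H c' x = classCount H c' y)
  have hr : Equivalence r :=
    ⟨fun _ => ⟨rfl, fun _ => rfl⟩, fun h => ⟨h.1.symm, fun h' => (h.2 (h.1 ▸ h')).symm⟩,
      fun h₁ h₂ => ⟨h₁.1.trans h₂.1, fun h' => (h₁.2 h').trans (h₂.2 (h₁.1 ▸ h'))⟩⟩
  refine (BraidEquiv.induction hr (fun l₁ l₂ a b =>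
    ⟨(BraidEquiv.of_move l₁ l₂ a b).closure_eq, fun hx => ?_⟩) h).2 hl
  have ha : a ∈ H := hx (Subgroup.subset_closure (by simp))
  have hb : b ∈ H := hx (Subgroup.subset_closure (by simp))
  have key : (∃ h : H, (h : G) = a * b * a⁻¹ ∧ ConjClasses.mk h = c') ↔
      ∃ h : H, (h : G) = b ∧ ConjClasses.mk h = c' := by
    have hmk : ConjClasses.mk (⟨a * b * a⁻¹, mul_mem (mul_mem ha hb) (inv_mem ha)⟩ : H) =
        ConjClasses.mk (⟨b, hb⟩ : H) := by
      refine (ConjClasses.mk_eq_mk_iff_isConj.2 (isConj_iff.2 ⟨(⟨a, ha⟩ : H), ?_⟩)).symm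
      rfl
    constructor
    · rintro ⟨h, h1, rfl⟩
      exact ⟨⟨b, hb⟩, rfl, by rw [← hmk]; congr 1; exact Subtype.ext h1.symm⟩
    · rintro ⟨h, rfl, rfl⟩
      exact ⟨_, rfl, hmk⟩
  simp only [classCount, List.countP_append, List.countP_cons, key]
  omega

theorem countP_eq_sum_count {α : Type*} [Fintype α] [DecidableEq α] (p : α → Prop)
    [DecidablePred p] (l : List α) :
    l.countP (fun a => decide (p a)) = ∑ a with p a, l.count a := by
  induction l with
  | nil => simp
  | cons b l ih =>
    simp only [List.countP_cons, List.count_cons, Finset.sum_add_distrib, ih, beq_iff_eq,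
      Finset.sum_ite_eq, Finset.mem_filter, Finset.mem_univ, true_and, decide_eq_true_eq]

/-- Since the multidiscriminant accounts for the whole length, all entries of a component tuple
lie in the classes in `D`. -/
theorem IsComponentTuple.mk_mem [Finite G] {D : Finset (ConjClasses G)} {ξ : D → ℕ} {n : ℕ}
    {l : List G} (h : IsComponentTuple D ξ n l) {g : G} (hg : g ∈ l) : ConjClasses.mk g ∈ D := by
  classical
  cases nonempty_fintype (ConjClasses G)
  have h1 : (l.map ConjClasses.mk).countP (fun c => decide (c ∈ D)) =
      (l.map ConjClasses.mk).length := by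
    rw [countP_eq_sum_count, List.length_map, h.length_eq, Finset.mul_sum,
      Finset.filter_univ_mem, ← Finset.sum_coe_sort D]
    refine Finset.sum_congr rfl fun c _ => ?_
    rw [← h.multidiscriminant_eq c, multidiscriminant, List.count_eq_countP, List.countP_map]
    congr 1
    funext g
    rw [Bool.eq_iff_iff]
    simp [ConjClasses.mem_carrier_iff_mk_eq]
  have := List.countP_eq_length.1 h1 (ConjClasses.mk g) (List.mem_map_of_mem hg)
  simpa using this

/-- The multidiscriminant fixes the number of entries in each class in `D`. Hence the numbers of
entries in the classes of `H` are determined once a single class of `H` above each class in `D`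
is left out. -/
theorem IsComponentTuple.map_mk_perm [Finite G] {D : Finset (ConjClasses G)} {ξ : D → ℕ}
    {H : Subgroup G} (b : D → ConjClasses H) (hb : ∀ c, ConjClasses.map H.subtype (b c) = c)
    {n : ℕ} {l₁ l₂ : List H} (h₁ : IsComponentTuple D ξ n (l₁.map Subtype.val))
    (h₂ : IsComponentTuple D ξ n (l₂.map Subtype.val))
    (h : ∀ c', ConjClasses.map H.subtype c' ∈ D → c' ∉ Set.range b →
      classCount H c' (l₁.map Subtype.val) = classCount H c' (l₂.map Subtype.val)) :
    (l₁.map ConjClasses.mk).Perm (l₂.map ConjClasses.mk) := by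
  classical
  cases nonempty_fintype (ConjClasses H)
  simp only [classCount_map_val] at h
  rw [List.perm_iff_count]
  have hout : ∀ (l : List H), IsComponentTuple D ξ n (l.map Subtype.val) →
      ∀ c', ConjClasses.map H.subtype c' ∉ D → (l.map ConjClasses.mk).count c' = 0 := by
    intro l hl c' hc'
    rw [List.count_eq_zero]
    intro hmem
    obtain ⟨x, hx, rfl⟩ := List.mem_map.1 hmem
    exact hc' (hl.mk_mem (List.mem_map_of_mem hx))
  intro c'
  by_cases hc' : ConjClasses.map H.subtype c' ∈ D
  · by_cases hcb : c' ∈ Set.range b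
    · obtain ⟨c, rfl⟩ := hcb
      have e₁ := h₁.multidiscriminant_eq c
      have e₂ := h₂.multidiscriminant_eq c
      rw [multidiscriminant_map_val, countP_eq_sum_count] at e₁ e₂
      have hmem : b c ∈ Finset.univ.filter
          fun c' => ConjClasses.map H.subtype c' = (c : ConjClasses G) := by simp [hb]
      rw [← Finset.add_sum_erase _ _ hmem] at e₁ e₂
      have hsum : ∑ x ∈ (Finset.univ.filter fun c' => ConjClasses.map H.subtype c' =
            (c : ConjClasses G)).erase (b c), (l₁.map ConjClasses.mk).count x =
          ∑ x ∈ (Finset.univ.filter fun c' => ConjClasses.map H.subtype c' =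
            (c : ConjClasses G)).erase (b c), (l₂.map ConjClasses.mk).count x := by
        refine Finset.sum_congr rfl fun x hx => ?_
        obtain ⟨hx1, hx2⟩ := Finset.mem_erase.1 hx
        have hx3 := (Finset.mem_filter.1 hx2).2
        refine h x (hx3 ▸ c.2) ?_
        rintro ⟨d, rfl⟩
        apply hx1
        congr 1
        exact Subtype.ext ((hb d).symm.trans hx3)
      omega
    · exact h c' hc' hcb
  · rw [hout l₁ h₁ c' hc', hout l₂ h₂ c' hc']

theorem mem_classesIn_iff {D : Finset (ConjClasses G)} {H : Subgroup G} {c' : ConjClasses H} :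
    c' ∈ classesIn D H ↔ ConjClasses.map H.subtype c' ∈ D := by
  obtain ⟨h, rfl⟩ := ConjClasses.mk_surjective c'
  constructor
  · rintro ⟨c, hc, hsub⟩
    have := hsub ⟨h, ConjClasses.mem_carrier_mk, rfl⟩
    rw [ConjClasses.mem_carrier_iff_mk_eq] at this
    rw [← this] at hc
    exact hc
  · intro hD
    refine ⟨_, hD, ?_⟩
    rintro _ ⟨x, hx, rfl⟩
    rw [ConjClasses.mem_carrier_iff_mk_eq] at hx ⊢
    rw [← hx]
    rfl

/-- The splitting number counts the classes of `H` above `D` apart from one chosen class above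
each class in `D`. -/
theorem splittingNumber_eq_natCard [Finite G] {D : Finset (ConjClasses G)} {H : Subgroup G}
    (b : D → ConjClasses H) (hb : ∀ c, ConjClasses.map H.subtype (b c) = c) :
    splittingNumber D H = Nat.card {c' : ConjClasses H //
      ConjClasses.map H.subtype c' ∈ D ∧ c' ∉ Set.range b} := by
  have hinj : Function.Injective b := fun c d hcd => by
    apply Subtype.ext
    rw [← hb c, hcd, hb d]
  have hsub : Set.range b ⊆ classesIn D H := by
    rintro _ ⟨c, rfl⟩
    rw [mem_classesIn_iff, hb]
    exact c.2
  have h1 := Set.ncard_sdiff_add_ncard_of_subset hsub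
  have h2 : (Set.range b).ncard = D.card := by
    rw [← Set.image_univ, Set.ncard_image_of_injective _ hinj, Set.ncard_univ]
    simp
  have h3 : Nat.card {c' : ConjClasses H // ConjClasses.map H.subtype c' ∈ D ∧
      c' ∉ Set.range b} = (classesIn D H \ Set.range b).ncard := by
    rw [← Nat.card_coe_set_eq]
    refine Nat.card_congr (Equiv.subtypeEquivRight fun c' => ?_)
    rw [Set.mem_sdiff, mem_classesIn_iff]
  rw [splittingNumber, h3]
  omega

theorem MeetsAll.exists_section {D : Finset (ConjClasses G)} {H : Subgroup G}
    (h : MeetsAll D H) : ∃ b : D → ConjClasses H, ∀ c, ConjClasses.map H.subtype (b c) = c := by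
  choose g hg using fun c : D => h c c.2
  exact ⟨fun c => ConjClasses.mk ⟨g c, (hg c).1⟩, fun c =>
    ConjClasses.mem_carrier_iff_mk_eq.1 (hg c).2⟩

end ClassCount

/-! ### Faces of the monoid of components -/

section Faces

variable {G : Type*} [Group G] {D : Finset (ConjClasses G)} {ξ : D → ℕ}

/-- The component represented by a component tuple. -/
def Comp.mk (t : ComponentTuple D ξ) : Comp D ξ := Quotient.mk _ t

theorem Comp.exists_mk (x : Comp D ξ) : ∃ t, Comp.mk t = x := Quotient.exists_rep x

theorem Comp.mk_mul_mk (s t : ComponentTuple D ξ) :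
    Comp.mk s * Comp.mk t = Comp.mk ⟨(s.1.1 + t.1.1, s.1.2 ++ t.1.2), s.2.append t.2⟩ := rfl

theorem Comp.one_def : (1 : Comp D ξ) = Comp.mk ⟨(0, []), .nil D ξ⟩ := rfl

theorem Comp.mk_eq_mk {s t : ComponentTuple D ξ} (h : s.1.1 = t.1.1)
    (h' : BraidEquiv s.1.2 t.1.2) : Comp.mk s = Comp.mk t :=
  Quotient.sound ⟨h, h'⟩

/-- The degree of a component. -/
def Comp.degree : Comp D ξ → ℕ := Quotient.lift (fun t => t.1.1) fun _ _ h => h.1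

/-- The subgroup generated by the entries of a component. -/
def Comp.support : Comp D ξ → Subgroup G :=
  Quotient.lift (fun t => Subgroup.closure {g | g ∈ t.1.2}) fun _ _ h => h.2.closure_eq

theorem Comp.support_mk (t : ComponentTuple D ξ) :
    (Comp.mk t).support = Subgroup.closure {g | g ∈ t.1.2} := rfl

theorem Comp.eq_one_of_degree_eq_zero {x : Comp D ξ} (hx : x.degree = 0) : x = 1 := by
  obtain ⟨t, rfl⟩ := x.exists_mk
  have h0 : t.1.1 = 0 := hx
  have h1 : t.1.2 = [] := by
    rw [← List.length_eq_zero_iff, t.2.length_eq, h0, zero_mul]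
  rw [Comp.one_def]
  exact Comp.mk_eq_mk h0 (.of_eq h1)

theorem Comp.degree_mul (x y : Comp D ξ) : (x * y).degree = x.degree + y.degree := by
  obtain ⟨s, rfl⟩ := x.exists_mk
  obtain ⟨t, rfl⟩ := y.exists_mk
  rfl

theorem Comp.support_one : (1 : Comp D ξ).support = ⊥ := by
  rw [Comp.one_def, Comp.support_mk, Subgroup.closure_eq_bot_iff]
  simp

theorem Comp.support_mul (x y : Comp D ξ) : (x * y).support = x.support ⊔ y.support := by
  obtain ⟨s, rfl⟩ := x.exists_mk
  obtain ⟨t, rfl⟩ := y.exists_mk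
  exact closure_append _ _

open Classical in
/-- The number of entries of a component which lie in the class `c'` of `H`. This is invariant
under braids for the components with entries in `H`; it is set to `0` for the others. -/
noncomputable def Comp.classCount (H : Subgroup G) (c' : ConjClasses H) : Comp D ξ → ℕ :=
  Quotient.lift
    (fun t => if Subgroup.closure {g | g ∈ t.1.2} ≤ H then
      HurwitzComponents.classCount H c' t.1.2 else 0)
    (fun s t h => by
      simp only [h.2.closure_eq]
      split_ifs with hH
      · exact h.2.classCount_eq c' (h.2.closure_eq ▸ hH)
      · rfl)

theorem Comp.classCount_mk {H : Subgroup G} (c' : ConjClasses H) {t : ComponentTuple D ξ}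
    (ht : (Comp.mk t).support ≤ H) :
    (Comp.mk t).classCount H c' = HurwitzComponents.classCount H c' t.1.2 :=
  if_pos ht

variable (D ξ) in
/-- The submonoid of the components with entries in `H`. -/
def face (H : Subgroup G) : Submonoid (Comp D ξ) where
  carrier := {x | x.support ≤ H}
  one_mem' := by simp [Comp.support_one]
  mul_mem' {x y} hx hy := by
    rw [Set.mem_ofPred_eq, Comp.support_mul]
    exact sup_le hx hy

theorem mem_face {H : Subgroup G} {x : Comp D ξ} : x ∈ face D ξ H ↔ x.support ≤ H := Iff.rfl

theorem mem_face_of_mul_mem {H : Subgroup G} {x y : Comp D ξ} (h : x * y ∈ face D ξ H) :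
    x ∈ face D ξ H ∧ y ∈ face D ξ H := by
  simpa only [mem_face, Comp.support_mul, sup_le_iff] using h

/-- The homomorphism recording the degree and the numbers of entries in the given classes
of `H`, for the components with entries in `H`. -/
noncomputable def exponents {H : Subgroup G} (p : ConjClasses H → Prop) :
    face D ξ H →* Multiplicative (Option {c' // p c'} → ℕ) where
  toFun x := Multiplicative.ofAdd fun o =>
    o.elim (x : Comp D ξ).degree fun c' => (x : Comp D ξ).classCount H c'
  map_one' := by
    apply Multiplicative.toAdd.injective
    funext o
    rcases o with _ | c'
    · rfl
    · exact Comp.classCount_mk (t := ⟨(0, []), .nil D ξ⟩) c'.1 (face D ξ H).one_mem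
  map_mul' := by
    rintro ⟨x, hx⟩ ⟨y, hy⟩
    obtain ⟨s, rfl⟩ := x.exists_mk
    obtain ⟨t, rfl⟩ := y.exists_mk
    apply Multiplicative.toAdd.injective
    funext o
    rcases o with _ | c'
    · rfl
    · change (Comp.mk s * Comp.mk t).classCount H c' =
        (Comp.mk s).classCount H c' + (Comp.mk t).classCount H c'
      have hst := (face D ξ H).mul_mem hx hy
      rw [Comp.mk_mul_mk] at hst ⊢
      rw [Comp.classCount_mk _ hx, Comp.classCount_mk _ hy, Comp.classCount_mk _ hst]
      exact List.countP_append

theorem exponents_none {H : Subgroup G} (p : ConjClasses H → Prop) (x : face D ξ H) :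
    (exponents p x).toAdd none = (x : Comp D ξ).degree := rfl

theorem exponents_some {H : Subgroup G} (p : ConjClasses H → Prop) (x : face D ξ H)
    (c' : {c' // p c'}) :
    (exponents p x).toAdd (some c') = (x : Comp D ξ).classCount H c' := rfl

/-- The classes of `H` above `D`, apart from the chosen ones. -/
abbrev IsExtraClass {H : Subgroup G} (b : D → ConjClasses H) (c' : ConjClasses H) : Prop :=
  ConjClasses.map H.subtype c' ∈ D ∧ c' ∉ Set.range b

/-- After multiplication by a component `z`, there are boundedly many components with entries in
the subgroup generated by the entries of `z` and with given exponents. -/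
theorem exists_pigeonhole_bound_face [Finite G] {z : Comp D ξ} {H : Subgroup G}
    (hz : z.support = H) (b : D → ConjClasses H)
    (hb : ∀ c, ConjClasses.map H.subtype (b c) = c) :
    ∃ J : ℕ, ∀ y : Fin (J + 1) → face D ξ H,
      (∀ i j, exponents (IsExtraClass b) (y i) = exponents (IsExtraClass b) (y j)) →
      ∃ i j, i < j ∧ z * (y i : Comp D ξ) = z * (y j : Comp D ξ) := by
  obtain ⟨t, rfl⟩ := z.exists_mk
  obtain ⟨l, hl⟩ := exists_map_val_eq (l := t.1.2) hz.le
  have prod_val : ∀ m : List H, (m.map Subtype.val).prod = 1 → m.prod = 1 := fun m hm =>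
    H.subtype_injective (by rw [map_list_prod, map_one]; exact hm)
  obtain ⟨J, hJ⟩ := exists_pigeonhole_bound H
  refine ⟨J, fun y hy => ?_⟩
  choose s hs using fun i => (y i : Comp D ξ).exists_mk
  have hsH : ∀ i, (Comp.mk (s i)).support ≤ H := fun i => (hs i).symm ▸ (y i).2
  choose m hm using fun i => exists_map_val_eq (hsH i)
  have hcomp : ∀ i, IsComponentTuple D ξ (s i).1.1 ((m i).map Subtype.val) :=
    fun i => (hm i).symm ▸ (s i).2
  have hdeg : ∀ i j, (s i).1.1 = (s j).1.1 := by
    intro i j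
    have := congrFun (congrArg Multiplicative.toAdd (hy i j)) none
    rwa [exponents_none, exponents_none, ← hs, ← hs] at this
  have hperm : ∀ i j, ((m i).map ConjClasses.mk).Perm ((m j).map ConjClasses.mk) := by
    intro i j
    refine (hcomp i).map_mk_perm b hb (hdeg i j ▸ hcomp j) fun c' h₁ h₂ => ?_
    have := congrFun (congrArg Multiplicative.toAdd (hy i j)) (some ⟨c', h₁, h₂⟩)
    rwa [exponents_some, exponents_some, ← hs, ← hs, Comp.classCount_mk _ (hsH i),
      Comp.classCount_mk _ (hsH j), ← hm, ← hm] at this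
  obtain ⟨i, j, hij, hbr⟩ := hJ l (prod_val l (hl ▸ t.2.prod_eq_one))
    (closure_eq_top_of_map_val (hl ▸ hz)) m (fun i => prod_val _ (hcomp i).prod_eq_one) hperm
  refine ⟨i, j, hij, ?_⟩
  rw [← hs i, ← hs j, Comp.mk_mul_mk, Comp.mk_mul_mk]
  refine Comp.mk_eq_mk (congrArg (t.1.1 + ·) (hdeg i j)) ?_
  have := hbr.map H.subtype
  simp only [List.map_append, Subgroup.coe_subtype] at this
  rwa [hl, hm, hm] at this

/-- For any choice `s` of classes of `H` above the classes in `D`, there is a component of degree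
`|H|` all of whose entries lie in the chosen classes. -/
theorem exists_component_of_section [Finite G] {H : Subgroup G} (s : D → ConjClasses H)
    (hs : ∀ c, ConjClasses.map H.subtype (s c) = c) :
    ∃ x : face D ξ H, (x : Comp D ξ).degree = Nat.card H ∧
      (∀ c, (x : Comp D ξ).classCount H (s c) = Nat.card H * ξ c) ∧
      ∀ c', c' ∉ Set.range s → (x : Comp D ξ).classCount H c' = 0 := by
  classical
  let cs : List (ConjClasses H) :=
    (Finset.univ : Finset D).toList.flatMap fun c => List.replicate (ξ c) (s c)
  have hinj : Function.Injective s := fun c d hcd => by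
    apply Subtype.ext
    rw [← hs c, hcd, hs d]
  have hcount : ∀ p : ConjClasses H → Bool,
      cs.countP p = ∑ c, if p (s c) = true then ξ c else 0 := by
    intro p
    simp only [cs, List.countP_flatMap, Function.comp_def, List.countP_replicate]
    exact Finset.sum_map_toList _ _
  have hclass : ∀ c', classCount H c' ((powerTuple cs).map Subtype.val) =
      Nat.card H * ∑ c, if s c = c' then ξ c else 0 := by
    intro c'
    rw [classCount_map_val, List.count_eq_countP, countP_powerTuple, hcount]
    simp
  have ht : IsComponentTuple D ξ (Nat.card H) ((powerTuple cs).map Subtype.val) := by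
    refine ⟨?_, fun c => ?_, ?_⟩
    · have h1 := countP_powerTuple (fun _ => true) cs
      rw [hcount] at h1
      simpa using h1
    · rw [multidiscriminant_map_val, countP_powerTuple, hcount]
      simp [hs]
    · have := congrArg H.subtype (powerTuple_prod cs)
      rwa [map_list_prod, map_one] at this
  have hmem : Comp.mk ⟨(Nat.card H, (powerTuple cs).map Subtype.val), ht⟩ ∈ face D ξ H :=
    closure_map_val_le _
  refine ⟨⟨_, hmem⟩, rfl, fun c => ?_, fun c' hc' => ?_⟩
  · rw [Comp.classCount_mk _ hmem, hclass]
    simp [hinj.eq_iff]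
  · rw [Comp.classCount_mk _ hmem, hclass, Finset.sum_eq_zero, mul_zero]
    exact fun c _ => if_neg fun h => hc' ⟨c, h⟩

end Faces

/-! ### The Krull dimension of the ring of components -/

section Dimension

variable {G : Type*} [Group G] [Finite G] {D : Finset (ConjClasses G)} {ξ : D → ℕ}

theorem splittingNumber_add_one_le_ringKrullDim (hξ : ∀ c, 0 < ξ c) (k : Type*) [Field k]
    {H : Subgroup G} (hH : MeetsAll D H) {m : ℕ} (hm : splittingNumber D H = m) :
    (m : WithBot ℕ∞) + 1 ≤ ringKrullDim (RingOfComponents k D ξ) := by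
  classical
  obtain ⟨b, hb⟩ := hH.exists_section
  obtain ⟨t, ht, ht₁, ht₂⟩ := exists_component_of_section (ξ := ξ) b hb
  -- Replace the chosen class above one class of `D` by the extra class `c'`.
  let s : {c' // IsExtraClass b c'} → D → ConjClasses H := fun c' =>
    Function.update b ⟨_, c'.2.1⟩ c'
  have hs : ∀ c' c, ConjClasses.map H.subtype (s c' c) = c := by
    intro c' c
    by_cases h : c = ⟨_, c'.2.1⟩
    · subst h
      simp [s]
    · simp only [s, Function.update_of_ne h, hb]
  choose u hu hu₁ hu₂ using fun c' => exists_component_of_section (ξ := ξ) (s c') (hs c')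
  have hcard : Nat.card {c' // IsExtraClass b c'} = m := by
    have := splittingNumber_eq_natCard b hb
    rw [hm] at this
    exact_mod_cast this.symm
  have hpos : 0 < Nat.card H := Nat.card_pos
  have key := card_le_ringKrullDim_monoidAlgebra (k := k) (face D ξ H)
    (fun x y => mem_face_of_mul_mem) (exponents (IsExtraClass b)) t u
    (by rw [exponents_none, ht]; exact hpos.ne')
    (fun c' => by rw [exponents_some]; exact ht₂ c' c'.2.2)
    (fun c' => by rw [exponents_none, exponents_none, hu, ht])
    (fun c' => by
      have := hu₁ c' ⟨_, c'.2.1⟩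
      simp only [s, Function.update_self] at this
      rw [exponents_some, this]
      exact (mul_pos hpos (hξ _)).ne')
    (fun c' d' hd => by
      rw [exponents_some]
      refine hu₂ c' d' ?_
      rintro ⟨c, hc⟩
      by_cases h : c = ⟨_, c'.2.1⟩
      · subst h
        simp only [s, Function.update_self] at hc
        exact hd (Subtype.ext hc.symm)
      · simp only [s, Function.update_of_ne h] at hc
        exact d'.2.2 ⟨c, hc⟩)
  rw [Finite.card_option, hcard] at key
  exact_mod_cast key

/-- A component of positive degree generates a `D`-generated subgroup which meets all classes
in `D`. -/
theorem Comp.isDGenerated_support (hξ : ∀ c, 0 < ξ c) {x : Comp D ξ} (hx : 0 < x.degree) :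
    MeetsAll D x.support ∧ IsDGenerated D x.support := by
  classical
  obtain ⟨t, rfl⟩ := x.exists_mk
  have hmeet : MeetsAll D (Comp.mk t).support := by
    intro c hc
    have h1 : 0 < multidiscriminant t.1.2 c := by
      rw [t.2.multidiscriminant_eq ⟨c, hc⟩]
      exact mul_pos hx (hξ _)
    obtain ⟨g, hg, hgc⟩ := List.countP_pos_iff.1 h1
    exact ⟨g, Subgroup.subset_closure hg, by simpa using hgc⟩
  refine ⟨hmeet, Or.inr ⟨hmeet, le_antisymm ?_ ?_⟩⟩
  · rw [Comp.support_mk, Subgroup.closure_le]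
    intro g hg
    refine Subgroup.subset_closure ?_
    simp only [Set.mem_iUnion]
    exact ⟨_, t.2.mk_mem hg, ConjClasses.mem_carrier_mk, Subgroup.subset_closure hg⟩
  · rw [Subgroup.closure_le]
    intro g hg
    simp only [Set.mem_iUnion] at hg
    obtain ⟨_, _, _, hg⟩ := hg
    exact hg

/-- The elements of the monoid outside a prime ideal `P` are the elements of a face; if `z` is one
of them generating a subgroup `H` as large as possible, then all of them have entries in `H`, and
the exponents relative to `H` bound the number of algebraically independent ones. -/
theorem ringKrullDim_le_of_splittingNumber_le (hξ : ∀ c, 0 < ξ c) (k : Type*) [Field k] {m : ℕ}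
    (hm : ∀ H : Subgroup G, IsDGenerated D H → MeetsAll D H → splittingNumber D H ≤ m) :
    ringKrullDim (RingOfComponents k D ξ) ≤ (m : WithBot ℕ∞) + 1 := by
  have : ringKrullDim (RingOfComponents k D ξ) ≤ ((m + 1 : ℕ) : WithBot ℕ∞) := by
    refine ringKrullDim_monoidAlgebra_le (m + 1) fun P _ l x hx => ?_
    let f : Comp D ξ →* MonoidAlgebra k (Comp D ξ) ⧸ P :=
      (Ideal.Quotient.mk P : _ →* _).comp (MonoidAlgebra.of k (Comp D ξ))
    have hf : ∀ i, f (x i) ≠ 0 := fun i => hx.ne_zero i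
    have hone : ∀ i, x i ≠ 1 := by
      intro i hi
      refine hx.transcendental i ?_
      have : f (x i) = 1 := by rw [hi, map_one]
      change IsAlgebraic k (f (x i))
      rw [this]
      exact isAlgebraic_one
    rcases Nat.eq_zero_or_pos l with rfl | hl
    · omega
    obtain ⟨z, hz, hmax⟩ : ∃ z, f z ≠ 0 ∧ ∀ y, f y ≠ 0 → z.support ≤ y.support →
        y.support = z.support := by
      obtain ⟨H, ⟨z, hz, rfl⟩, hH⟩ := Set.Finite.exists_maximal
        (s := Comp.support '' {z : Comp D ξ | f z ≠ 0}) (Set.toFinite _)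
        ⟨_, x ⟨0, hl⟩, hf _, rfl⟩
      exact ⟨z, hz, fun y hy h => le_antisymm (hH ⟨y, hy, rfl⟩ h) h⟩
    have hle : ∀ y, f y ≠ 0 → y.support ≤ z.support := by
      intro y hy
      rw [← hmax (z * y) (by rw [map_mul]; exact mul_ne_zero hz hy)
        (by rw [Comp.support_mul]; exact le_sup_left), Comp.support_mul]
      exact le_sup_right
    have hsupp : (z * x ⟨0, hl⟩).support = z.support := by
      rw [Comp.support_mul]
      exact sup_eq_left.2 (hle _ (hf _))
    have hdeg : 0 < (z * x ⟨0, hl⟩).degree :=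
      Nat.pos_of_ne_zero fun h0 => hone ⟨0, hl⟩ (Comp.eq_one_of_degree_eq_zero (by
        rw [Comp.degree_mul] at h0
        omega))
    obtain ⟨hmeet, hgen⟩ := Comp.isDGenerated_support hξ hdeg
    rw [hsupp] at hmeet hgen
    obtain ⟨b, hb⟩ := hmeet.exists_section
    have hcard : Nat.card {c' // IsExtraClass b c'} ≤ m := by
      have := hm _ hgen hmeet
      rw [splittingNumber_eq_natCard b hb] at this
      exact_mod_cast this
    obtain ⟨J, hJ⟩ := exists_pigeonhole_bound_face rfl b hb
    let K : Submonoid (Comp D ξ) :=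
      { carrier := {y | f y ≠ 0}
        one_mem' := by simp
        mul_mem' := fun {y y'} hy hy' => by
          rw [Set.mem_ofPred_eq, map_mul]
          exact mul_ne_zero hy hy' }
    have hK : K ≤ face D ξ z.support := hle
    have key := card_le_of_algebraicIndependent (k := k) (f.comp K.subtype) (fun y => y.2)
      ((exponents (IsExtraClass b)).comp (Submonoid.inclusion hK)) J ⟨z, hz⟩
      (fun y hy => by
        obtain ⟨i, j, hij, h⟩ := hJ (fun i => Submonoid.inclusion hK (y i)) hy
        exact ⟨i, j, hij, Subtype.ext h⟩)
      (fun i => ⟨x i, hf i⟩) hx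
    rw [Nat.card_fin, Finite.card_option] at key
    omega
  exact_mod_cast this

end Dimension

end HurwitzComponents

theorem mainTheorem11 {G : Type*} [Group G] [Finite G]
    (D : Finset (ConjClasses G))
    (hD_nontrivial : ConjClasses.mk (1 : G) ∉ D)
    (hD_generates : Subgroup.closure (⋃ c ∈ D, c.carrier) = ⊤)
    (ξ : D → ℕ) (hξ : ∀ c, 0 < ξ c)
    (k : Type*) [Field k] (hk : (Nat.card G : k) ≠ 0) :
    ∃ m : ℕ,
      IsGreatest
        {z : ℤ | ∃ H : Subgroup G, HurwitzComponents.IsDGenerated D H ∧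
          HurwitzComponents.MeetsAll D H ∧ z = HurwitzComponents.splittingNumber D H} (m : ℤ) ∧
      ringKrullDim (HurwitzComponents.RingOfComponents k D ξ) = (m : WithBot ℕ∞) + 1 := by
  set S := {z : ℤ | ∃ H : Subgroup G, HurwitzComponents.IsDGenerated D H ∧
    HurwitzComponents.MeetsAll D H ∧ z = HurwitzComponents.splittingNumber D H} with hS
  have hfin : S.Finite := (Set.finite_range (HurwitzComponents.splittingNumber D)).subset (by
    rintro _ ⟨H, _, _, rfl⟩
    exact ⟨H, rfl⟩)
  have hne : S.Nonempty := by
    have hmeet : HurwitzComponents.MeetsAll D (⊤ : Subgroup G) := fun c _ => by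
      obtain ⟨g, rfl⟩ := ConjClasses.mk_surjective c
      exact ⟨g, Subgroup.mem_top g, ConjClasses.mem_carrier_mk⟩
    exact ⟨_, ⊤, Or.inr ⟨hmeet, by simpa using hD_generates.symm⟩, hmeet, rfl⟩
  obtain ⟨M, ⟨H, hgen, hmeet, rfl⟩, hmax⟩ := Set.exists_max_image S id hfin hne
  obtain ⟨b, hb⟩ := hmeet.exists_section
  have hm := HurwitzComponents.splittingNumber_eq_natCard b hb
  refine ⟨_, ⟨⟨H, hgen, hmeet, hm.symm⟩, fun z hz => hm ▸ hmax z hz⟩, le_antisymm ?_ ?_⟩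
  · exact HurwitzComponents.ringKrullDim_le_of_splittingNumber_le hξ k
      fun H' hgen' hmeet' => hm ▸ hmax _ ⟨H', hgen', hmeet', rfl⟩
  · exact HurwitzComponents.splittingNumber_add_one_le_ringKrullDim hξ k hmeet hm
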